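/- **Maps.** A map with edge type with $n\ge 1$ edges consists of the edge set $E=\{1,\dots,n\}$, the full cycle $\sigma_\bullet=(1\,2\cdots n)$ (the single black vertex, edges being labelled counterclockwise around it), a permutation $\sigma_\circ$ of $E$ whose cycles (fixed points included) are the white vertices, the edge following $e$ counterclockwise around its white vertex being $\sigma_\circ(e)$, and a type function $t:E\to\{0,1\}$ with $t(e+1)\neq t(e)$ for $1\le e<n$. The map is planar if $\#\sigma_\circ-n+\#(\sigma_\bullet\sigma_\circ)-1=0$, where $\#$ denotes the number of cycles. Its weight is $$\mathrm{wt}(\mathcal M)=\prod_{v}c\,y^{\mathrm{alt}(v)},$$ where $v$ runs over the white vertices and $\mathrm{alt}(v)$ is the number of edges $e$ of the cycle $v$ with $t(\sigma_\circ(e))\ne t(e)$. **Petals.** A petal is a planar map with $n\ge1$ edges such that $\sigma_\circ(1)=\sigma_\bullet^{-1}(1)$. Its first external edge is $e=1$ and its second external edge is $e^*=\sigma_\circ(1)$. For $i,j\in\{0,1\}$ let $$B_{ij}(x,y,c)=\sum_{n\ge1}x^n\sum_{\mathcal P}\mathrm{wt}(\mathcal P),$$ where $\mathcal P$ runs over the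 petals with $n$ edges with $t(e^*)=i$ and $t(e)=j$. **Sequences of petals.** Write $\bar0=1$, $\bar1=0$. For $i,j\in\{0,1\}$ let $$S_{ij}(x,y,c)=\sum_{(\mathcal P_1,\dots,\mathcal P_q)}\ \prod_{r=1}^q x^{|\mathcal P_r|}\,\mathrm{wt}(\mathcal P_r),$$ where $|\mathcal P|$ is the number of edges of $\mathcal P$ and the sum is over all finite sequences of petals such that the first external edge of $\mathcal P_1$ has type $j$, the second external edge of $\mathcal P_q$ has type $i$, and for $1\le r<q$ the first external edge of $\mathcal P_{r+1}$ has the type opposite to that of the second external edge of $\mathcal P_r$; the empty sequence ($q=0$) contributes $1$ if $i=\bar j$ and is excluded if $i=j$. **Proposition.** Let $y$ and $c$ be elements of a commutative ring $R$ (for instance indeterminates, or real numbers $y=1/m$ and $c>0$). For each $a\in\{0,1\}$ the following identities of formal power series in $x$ over $R$ hold: $$B_{aa}=cx+x\,S_{\bar a\bar a}B_{aa}+x\,S_{\bar a a}B_{\bar a a},$$ $$B_{a\bar a}=x\,S_{\bar a\bar a}B_{a\bar a}+y^2x\,S_{\bar a a}B_{\bar a\bar a}.$$ -/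

import Mathlib

open scoped PowerSeries

namespace PetalMaps

/-- The cycles of a permutation, fixed points included. -/
abbrev Cycles {n : ℕ} (σ : Equiv.Perm (Fin n)) : Type :=
  Quotient (Equiv.Perm.SameCycle.setoid σ)

instance {n : ℕ} (σ : Equiv.Perm (Fin n)) : DecidableEq (Cycles σ) :=
  @Quotient.decidableEq _ (Equiv.Perm.SameCycle.setoid σ)
    (fun e f => inferInstanceAs (Decidable (σ.SameCycle e f)))

instance {n : ℕ} (σ : Equiv.Perm (Fin n)) : Fintype (Cycles σ) :=
  @Quotient.fintype _ _ (Equiv.Perm.SameCycle.setoid σ)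
    (fun e f => inferInstanceAs (Decidable (σ.SameCycle e f)))

/-- The number of cycles of a permutation, fixed points included. -/
def numCycles {n : ℕ} (σ : Equiv.Perm (Fin n)) : ℕ :=
  Fintype.card (Cycles σ)

/-- A combinatorial map with edge type, with one black vertex and `n` edges.
The edges are labelled by `Fin n` in counterclockwise order around the black vertex, so that
`finRotate n` (the full cycle) is the permutation of the black vertex.
The white vertices are the cycles of `white`; going around a white vertex counterclockwise,
the edge that follows `e` is `white e`. The two types `0`, `1` of edges are `false`, `true`;
they alternate along the labelling. -/
@[ext]
structure TypedMap (n : ℕ) where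
  /-- the permutation whose cycles are the white vertices -/
  white : Equiv.Perm (Fin n)
  /-- the types of the edges -/
  type : Fin n → Bool
  /-- consecutive edges around the black vertex, from the first to the last, alternate in type -/
  alternating : ∀ e f : Fin n, (f : ℕ) = (e : ℕ) + 1 → type f = !(type e)

namespace TypedMap

variable {n : ℕ}

/-- The white vertices, as cycles of the permutation `white`. -/
abbrev WhiteVertex (M : TypedMap n) : Type :=
  Cycles M.white

/-- Planarity: the faces are the cycles of (black permutation) ∘ (white permutation), and
`#white vertices - #edges + #faces - 1 = 0`. -/
def IsPlanar (M : TypedMap n) : Prop :=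
  numCycles M.white + numCycles (finRotate n * M.white) = n + 1

/-- The number of changes of edge type met when going once around the white vertex `v`. -/
def alt (M : TypedMap n) (v : M.WhiteVertex) : ℕ :=
  (Finset.univ.filter fun e : Fin n =>
    (Quotient.mk (Equiv.Perm.SameCycle.setoid M.white) e : M.WhiteVertex) = v ∧
      M.type (M.white e) ≠ M.type e).card

/-- The weight of a map: each white vertex `v` contributes `c * y ^ alt v`. -/
def weight {R : Type*} [CommRing R] (y c : R) (M : TypedMap n) : R :=
  ∏ v : M.WhiteVertex, c * y ^ M.alt v

instance : Finite (TypedMap n) :=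
  Finite.of_injective (fun M : TypedMap n => (M.white, M.type)) (by
    intro M M' h
    exact TypedMap.ext (congrArg Prod.fst h) (congrArg Prod.snd h))

end TypedMap

/-- A petal with `n ≥ 1` edges: a planar map, rooted at its first edge, such that the edge that
follows the root counterclockwise around its white vertex is also the edge that follows the root
clockwise around the black vertex. -/
@[ext]
structure Petal (n : ℕ) extends TypedMap n where
  /-- there is at least one edge -/
  pos : 0 < n
  /-- the underlying map is planar -/
  planar : toTypedMap.IsPlanar
  /-- the next edge counterclockwise at the white vertex of the root is the next edge clockwise
  at the black vertex -/
  closed : white ⟨0, pos⟩ = (finRotate n)⁻¹ ⟨0, pos⟩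

namespace Petal

variable {n : ℕ}

/-- The first external edge of a petal: its root `e`. -/
def firstEdge (P : Petal n) : Fin n := ⟨0, P.pos⟩

/-- The second external edge of a petal: the complement `e*` of its root `e`, which follows `e`
counterclockwise around the white vertex. -/
def secondEdge (P : Petal n) : Fin n := P.white P.firstEdge

/-- The type of the first external edge. -/
def firstType (P : Petal n) : Bool := P.type P.firstEdge

/-- The type of the second external edge. -/
def secondType (P : Petal n) : Bool := P.type P.secondEdge

instance : Finite (Petal n) :=
  Finite.of_injective (fun P : Petal n => P.toTypedMap) (by
    rintro ⟨M, _, _, _⟩ ⟨M', _, _, _⟩ h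
    cases h
    rfl)

noncomputable instance : Fintype (Petal n) := Fintype.ofFinite _

end Petal

/-- `IsPetalSeq i j l`: the list `l` of petals (the first petal is the head of the list) is a
sequence of petals in which the first external edge of the first petal has type `j`, the second
external edge of the last petal has type `i`, and the first external edge of each petal but the
first has the type opposite to that of the second external edge of the preceding petal.
The empty sequence is admitted exactly when `i` and `j` are opposite. -/
def IsPetalSeq (i : Bool) : Bool → List (Σ n, Petal n) → Prop
  | j, [] => i = !j
  | j, P :: l => P.2.firstType = j ∧ IsPetalSeq i (!P.2.secondType) l

/-- The total number of edges of a list of petals. -/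
def numEdges (l : List (Σ n, Petal n)) : ℕ := (l.map fun P => P.1).sum

/-- The sequences of petals with `N` edges in total and extremal types `i` (end), `j` (start). -/
def petalSeqs (i j : Bool) (N : ℕ) : Set (List (Σ n, Petal n)) :=
  {l | IsPetalSeq i j l ∧ numEdges l = N}

theorem finite_numEdges (N : ℕ) : {l : List (Σ n, Petal n) | numEdges l = N}.Finite := by
  induction N using Nat.strong_induction_on with
  | _ N ih =>
    have key : {l : List (Σ n, Petal n) | numEdges l = N} ⊆
        {[]} ∪ ⋃ k : Fin (N + 1), ⋃ P : Petal k, ⋃ _ : 0 < (k : ℕ),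
          (fun l => (⟨(k : ℕ), P⟩ : Σ n, Petal n) :: l) '' {l | numEdges l = N - k} := by
      rintro (_ | ⟨⟨k, P⟩, l⟩) hl
      · exact Or.inl rfl
      · right
        have h : k + numEdges l = N := by simpa [numEdges] using hl
        simp only [Set.mem_iUnion]
        exact ⟨⟨k, by omega⟩, P, P.pos, l, by simp only [Set.mem_ofPred_eq]; omega, rfl⟩
    refine Set.Finite.subset ?_ key
    refine (Set.finite_singleton _).union ?_
    refine Set.finite_iUnion fun k => Set.finite_iUnion fun P => Set.finite_iUnion fun hk => ?_
    exact (ih _ (by omega)).image _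

theorem finite_petalSeqs (i j : Bool) (N : ℕ) : (petalSeqs i j N).Finite :=
  (finite_numEdges N).subset fun _ h => h.2

variable {R : Type*} [CommRing R]

/-- The generating function `B_{ij}(x, y, c)` of petals, a formal power series in the variable `x`
that counts edges: the second external edge has type `i`, the first one has type `j`. -/
noncomputable def B (y c : R) (i j : Bool) : R⟦X⟧ :=
  PowerSeries.mk fun n =>
    ∑ P : Petal n with P.secondType = i ∧ P.firstType = j, P.weight y c

/-- The generating function `S_{ij}(x, y, c)` of sequences of petals, weighted by the product of the
weights of the petals: the second external edge of the last petal has type `i`, the first external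
edge of the first petal has type `j`. -/
noncomputable def S (y c : R) (i j : Bool) : R⟦X⟧ :=
  PowerSeries.mk fun N =>
    ∑ l ∈ (finite_petalSeqs i j N).toFinset, (l.map fun P => P.2.weight y c).prod

end PetalMaps

/-! In a planar map with one black vertex, the white vertices form a noncrossing partition whose
blocks are visited in decreasing order (`isPlanar_iff_noncrossing`). Since types alternate, a change
of type is an odd jump of labels, and each cycle has exactly one weak exceedance. The weight is
therefore a product over edges depending only on the permutation (`TypedMap.weight_eq_permWeight`).

A petal is then a noncrossing permutation sending the first edge to the last. Cutting a noncrossing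
permutation after the image of its first edge splits off a petal; `planarSum` and `S` thus satisfy
the same recursion. Hence each coefficient of `B` or `S` is `petalSum` or `planarSum`, subject to a
parity condition on the number of edges (`coeff_B`, `coeff_S`).

Removing the last edge of a petal with at least two edges leaves an arbitrary noncrossing
permutation, that is, a smaller petal followed by a planar remainder. Only the parities near the
removed edge can change the weight, by a factor `y ^ 2` or none (`permWeight_insertLast`). Sorting
`petalSum_succ_eq_antidiagonal` by parity gives both identities. -/

namespace PetalMaps

/-! ### Counting cycles by weak exceedances and weak descents -/

section Cycles

variable {n : ℕ}

/-- The cycle of `σ` through `e`. -/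
def cycleOfEdge (σ : Equiv.Perm (Fin n)) (e : Fin n) : Cycles σ :=
  Quotient.mk (Equiv.Perm.SameCycle.setoid σ) e

theorem cycleOfEdge_eq_iff {σ : Equiv.Perm (Fin n)} {e f : Fin n} :
    cycleOfEdge σ e = cycleOfEdge σ f ↔ σ.SameCycle e f :=
  Quotient.eq (r := Equiv.Perm.SameCycle.setoid σ)

/-- The smallest element of a cycle is a weak exceedance. -/
theorem surjective_cycleOfEdge_weakExceedance (σ : Equiv.Perm (Fin n)) :
    Function.Surjective fun e : {e : Fin n // e ≤ σ e} => cycleOfEdge σ e := by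
  intro q
  induction q using Quotient.inductionOn with
  | _ x =>
    obtain ⟨e, he, hmin⟩ := Finset.exists_min_image
      (Finset.univ.filter fun e => σ.SameCycle e x) id
      ⟨x, by simp [Equiv.Perm.SameCycle.refl]⟩
    simp only [Finset.mem_filter, Finset.mem_univ, true_and, id] at he hmin
    exact ⟨⟨e, hmin _ (Equiv.Perm.sameCycle_apply_left.2 he)⟩, cycleOfEdge_eq_iff.2 he⟩

theorem surjective_cycleOfEdge_weakDescent (σ : Equiv.Perm (Fin n)) :
    Function.Surjective fun e : {e : Fin n // σ e ≤ e} => cycleOfEdge σ e := by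
  intro q
  induction q using Quotient.inductionOn with
  | _ x =>
    obtain ⟨e, he, hmax⟩ := Finset.exists_max_image
      (Finset.univ.filter fun e => σ.SameCycle e x) id
      ⟨x, by simp [Equiv.Perm.SameCycle.refl]⟩
    simp only [Finset.mem_filter, Finset.mem_univ, true_and, id] at he hmax
    exact ⟨⟨e, hmax _ (Equiv.Perm.sameCycle_apply_left.2 he)⟩, cycleOfEdge_eq_iff.2 he⟩

theorem numCycles_le_card_weakExceedance (σ : Equiv.Perm (Fin n)) :
    numCycles σ ≤ Fintype.card {e : Fin n // e ≤ σ e} :=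
  Fintype.card_le_of_surjective _ (surjective_cycleOfEdge_weakExceedance σ)

theorem numCycles_le_card_weakDescent (σ : Equiv.Perm (Fin n)) :
    numCycles σ ≤ Fintype.card {e : Fin n // σ e ≤ e} :=
  Fintype.card_le_of_surjective _ (surjective_cycleOfEdge_weakDescent σ)

theorem numCycles_eq_card_weakExceedance_iff (σ : Equiv.Perm (Fin n)) :
    numCycles σ = Fintype.card {e : Fin n // e ≤ σ e} ↔
      ∀ e f, e ≤ σ e → f ≤ σ f → σ.SameCycle e f → e = f := by
  constructor
  · intro h e f he hf hef
    have hb := (Fintype.bijective_iff_surjective_and_card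
      fun e : {e : Fin n // e ≤ σ e} => cycleOfEdge σ e).2
      ⟨surjective_cycleOfEdge_weakExceedance σ, h.symm⟩
    exact congrArg Subtype.val (hb.1 (a₁ := ⟨e, he⟩) (a₂ := ⟨f, hf⟩) (cycleOfEdge_eq_iff.2 hef))
  · intro h
    refine (Fintype.card_of_bijective (f := fun e : {e : Fin n // e ≤ σ e} => cycleOfEdge σ e)
      ⟨?_, surjective_cycleOfEdge_weakExceedance σ⟩).symm
    rintro ⟨e, he⟩ ⟨f, hf⟩ hef
    exact Subtype.ext (h e f he hf (cycleOfEdge_eq_iff.1 hef))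

theorem numCycles_eq_card_weakDescent_iff (σ : Equiv.Perm (Fin n)) :
    numCycles σ = Fintype.card {e : Fin n // σ e ≤ e} ↔
      ∀ e f, σ e ≤ e → σ f ≤ f → σ.SameCycle e f → e = f := by
  constructor
  · intro h e f he hf hef
    have hb := (Fintype.bijective_iff_surjective_and_card
      fun e : {e : Fin n // σ e ≤ e} => cycleOfEdge σ e).2
      ⟨surjective_cycleOfEdge_weakDescent σ, h.symm⟩
    exact congrArg Subtype.val (hb.1 (a₁ := ⟨e, he⟩) (a₂ := ⟨f, hf⟩) (cycleOfEdge_eq_iff.2 hef))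
  · intro h
    refine (Fintype.card_of_bijective (f := fun e : {e : Fin n // σ e ≤ e} => cycleOfEdge σ e)
      ⟨?_, surjective_cycleOfEdge_weakDescent σ⟩).symm
    rintro ⟨e, he⟩ ⟨f, hf⟩ hef
    exact Subtype.ext (h e f he hf (cycleOfEdge_eq_iff.1 hef))

/-- Rotation adds one except at the last edge, which wraps to zero; the wrap is the source of the
second alternative. -/
theorem finRotate_mul_apply_le_iff (σ : Equiv.Perm (Fin (n + 1))) (e : Fin (n + 1)) :
    (finRotate (n + 1) * σ) e ≤ e ↔ σ e < e ∨ σ e = Fin.last n := by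
  rw [Equiv.Perm.mul_apply]
  rcases eq_or_ne (σ e) (Fin.last n) with h | h
  · simp [h]
  · have hv := coe_finRotate_of_ne_last h
    simp only [h, or_false, Fin.le_def, Fin.lt_def, hv]
    omega

/-- Weak exceedances and strict descents of `σ` account for all `n + 1` edges; the edge sent to the
last one is counted a second time because of the wrap. The total bounds the two cycle counts, so
planarity is the case where both bounds are attained. -/
theorem card_weakExceedance_add_card_weakDescent (σ : Equiv.Perm (Fin (n + 1))) :
    Fintype.card {e // e ≤ σ e} + Fintype.card {e // (finRotate (n + 1) * σ) e ≤ e} = n + 2 := by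
  simp only [finRotate_mul_apply_le_iff, Fintype.card_subtype]
  rw [Finset.filter_or, Finset.card_union_of_disjoint]
  · have h1 : (Finset.univ.filter fun e => σ e = Fin.last n) = {σ.symm (Fin.last n)} := by
      ext e
      simp [Equiv.eq_symm_apply]
    have h2 := Finset.card_filter_add_card_filter_not (s := Finset.univ) fun e => e ≤ σ e
    simp only [not_le, Finset.card_univ, Fintype.card_fin] at h2
    rw [h1, Finset.card_singleton]
    omega
  · rw [Finset.disjoint_filter]
    intro e _ h1 h2
    rw [h2] at h1
    exact absurd (Fin.le_last e) (not_le.2 h1)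

/-- A permutation is planar iff each of its cycles contains only one weak exceedance and each
cycle of its composition with the full cycle contains only one weak descent. -/
theorem numCycles_add_numCycles_eq_iff (σ : Equiv.Perm (Fin (n + 1))) :
    numCycles σ + numCycles (finRotate (n + 1) * σ) = n + 1 + 1 ↔
      (∀ e f, e ≤ σ e → f ≤ σ f → σ.SameCycle e f → e = f) ∧
        ∀ e f, (finRotate (n + 1) * σ) e ≤ e → (finRotate (n + 1) * σ) f ≤ f →
          (finRotate (n + 1) * σ).SameCycle e f → e = f := by
  rw [← numCycles_eq_card_weakExceedance_iff, ← numCycles_eq_card_weakDescent_iff]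
  have h1 := numCycles_le_card_weakExceedance σ
  have h2 := numCycles_le_card_weakDescent (finRotate (n + 1) * σ)
  have h3 := card_weakExceedance_add_card_weakDescent σ
  omega

end Cycles

/-! ### Planarity as a noncrossing condition -/

/-- A permutation whose cycles are the blocks of a noncrossing partition, each visited in
decreasing order: the interval strictly between `σ e` and `e`, when `σ e < e`, and the interval
from `e` to `σ e`, when `e ≤ σ e`, are invariant under `σ`. -/
def Noncrossing {n : ℕ} (σ : Equiv.Perm (Fin n)) : Prop :=
  ∀ e f : Fin n,
    (σ e < e → ((σ e < f ∧ f < e) ↔ (σ e < σ f ∧ σ f < e))) ∧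
      (e ≤ σ e → ((e ≤ f ∧ f ≤ σ e) ↔ (e ≤ σ f ∧ σ f ≤ σ e)))

/-- By finiteness, a subset that a permutation maps into itself is mapped onto itself. -/
theorem iff_apply_of_imp {α : Type*} [Finite α] (σ : Equiv.Perm α) {p : α → Prop}
    (h : ∀ a, p a → p (σ a)) (a : α) : p a ↔ p (σ a) := by
  refine ⟨h a, fun ha => ?_⟩
  have h' := σ.perm_symm_mapsTo_of_mapsTo (s := {a | p a}) (fun a ha => h a ha) ha
  simpa using h'

theorem imp_of_sameCycle {α : Type*} {σ : Equiv.Perm α} {p : α → Prop}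
    (h : ∀ a, p a ↔ p (σ a)) {a b : α} (hab : σ.SameCycle a b) : p a → p b := by
  obtain ⟨k, rfl⟩ := hab
  have key : ∀ k : ℤ, ∀ a, p a ↔ p ((σ ^ k) a) := by
    intro k
    induction k with
    | zero => simp
    | succ k ih => intro a; rw [zpow_add_one, Equiv.Perm.mul_apply, ← ih]; exact h a
    | pred k ih =>
      intro a
      rw [zpow_sub_one, Equiv.Perm.mul_apply, ← ih, h (σ⁻¹ a)]
      simp
  exact (key k a).1

/-- The interval from a weak exceedance to its image is invariant, so it contains the whole cycle
and its left end is the minimum of that cycle. -/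
theorem Noncrossing.eq_of_sameCycle {n : ℕ} {σ : Equiv.Perm (Fin n)} (h : Noncrossing σ)
    {e f : Fin n} (he : e ≤ σ e) (hf : f ≤ σ f) (hef : σ.SameCycle e f) : e = f :=
  le_antisymm
    (imp_of_sameCycle (p := fun g => e ≤ g ∧ g ≤ σ e) (fun g => (h e g).2 he) hef ⟨le_rfl, he⟩).1
    (imp_of_sameCycle (p := fun g => f ≤ g ∧ g ≤ σ f) (fun g => (h f g).2 hf) hef.symm
      ⟨le_rfl, hf⟩).1

/-- In a noncrossing permutation, a weak descent of the face permutation is the largest element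
of its cycle. -/
theorem Noncrossing.le_of_sameCycle_face {n : ℕ} {σ : Equiv.Perm (Fin (n + 1))}
    (h : Noncrossing σ) {e f : Fin (n + 1)} (he : (finRotate (n + 1) * σ) e ≤ e)
    (hef : (finRotate (n + 1) * σ).SameCycle e f) : f ≤ e := by
  rw [finRotate_mul_apply_le_iff] at he
  rcases he with he | he
  -- At a strict descent, the face permutation preserves the half-open interval `(σ e, e]`: `σ`
  -- keeps its interior in place and sends `e` to the excluded left end, and the rotation then adds
  -- one.
  · refine (imp_of_sameCycle (p := fun g => σ e < g ∧ g ≤ e)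
      (iff_apply_of_imp _ fun g hg => ?_) hef ⟨he, le_rfl⟩).2
    have hne : ∀ g, g ≤ e → σ e < g → σ g ≠ Fin.last n := by
      intro g hg hg'
      rcases hg.eq_or_lt with rfl | hlt
      · exact (he.trans_le (Fin.le_last _)).ne
      · exact ((((h e g).1 he).1 ⟨hg', hlt⟩).2.trans_le (Fin.le_last _)).ne
    have hv := coe_finRotate_of_ne_last (hne g hg.2 hg.1)
    have hin := ((h e g).1 he).1
    have hge : g = e ∨ g < e := hg.2.eq_or_lt
    rw [Equiv.Perm.mul_apply, Fin.le_def, Fin.lt_def, hv]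
    rcases hge with rfl | hlt
    · simp only [Fin.lt_def] at *; omega
    · have := hin ⟨hg.1, hlt⟩
      simp only [Fin.lt_def] at *; omega
  -- Here the final segment from `e` is `σ`-invariant, so `σ` keeps everything below `e` below `e`,
  -- while `e` itself wraps to zero.
  · refine imp_of_sameCycle (p := fun g => g ≤ e) (iff_apply_of_imp _ fun g hg => ?_) hef le_rfl
    rcases hg.eq_or_lt with rfl | hlt
    · simp [he]
    · have hle : e ≤ σ e := he ▸ Fin.le_last e
      have hg' : σ g < e := by
        by_contra hcon
        have := ((h e g).2 hle).2 ⟨not_lt.1 hcon, he ▸ Fin.le_last _⟩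
        exact absurd this.1 (not_le.2 hlt)
      have hv := coe_finRotate_of_ne_last (hg'.trans_le (Fin.le_last _)).ne
      rw [Equiv.Perm.mul_apply, Fin.le_def, hv]
      exact hg'

section Unique

variable {n : ℕ} {σ : Equiv.Perm (Fin (n + 1))}

/-- Both the minimum of a cycle and the preimage of its maximum are weak exceedances; uniqueness
identifies both with `e`. -/
theorem sameCycle_bounds_of_unique
    (h₁ : ∀ e f, e ≤ σ e → f ≤ σ f → σ.SameCycle e f → e = f) {e g : Fin (n + 1)}
    (he : e ≤ σ e) (hg : σ.SameCycle e g) : e ≤ g ∧ g ≤ σ e := by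
  constructor
  · obtain ⟨m, hm, hmin⟩ := Finset.exists_min_image
      (Finset.univ.filter fun m => σ.SameCycle e m) id ⟨g, by simpa using hg⟩
    simp only [Finset.mem_filter, Finset.mem_univ, true_and, id] at hm hmin
    rw [h₁ e m he (hmin _ (Equiv.Perm.sameCycle_apply_right.2 hm)) hm]
    exact hmin g hg
  · obtain ⟨m, hm, hmax⟩ := Finset.exists_max_image
      (Finset.univ.filter fun m => σ.SameCycle e m) σ ⟨e, by simp [Equiv.Perm.SameCycle.refl]⟩
    simp only [Finset.mem_filter, Finset.mem_univ, true_and] at hm hmax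
    have hmax' : ∀ x, σ.SameCycle e x → x ≤ σ m := fun x hx => by
      simpa using hmax (σ.symm x) (Equiv.Perm.sameCycle_symm_apply_right.2 hx)
    rw [h₁ e m he (hmax' m hm) hm]
    exact hmax' g hg

theorem le_of_sameCycle_of_unique {φ : Equiv.Perm (Fin (n + 1))}
    (h : ∀ e f, φ e ≤ e → φ f ≤ f → φ.SameCycle e f → e = f) {e g : Fin (n + 1)}
    (he : φ e ≤ e) (hg : φ.SameCycle e g) : g ≤ e := by
  obtain ⟨m, hm, hmax⟩ := Finset.exists_max_image
    (Finset.univ.filter fun m => φ.SameCycle e m) id ⟨g, by simpa using hg⟩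
  simp only [Finset.mem_filter, Finset.mem_univ, true_and, id] at hm hmax
  rw [h e m he (hmax _ (Equiv.Perm.sameCycle_apply_right.2 hm)) hm]
  exact hmax g hg

/-- The interval between `e` and `σ e` is cut by the cycle of `e`. -/
theorem exists_mem_descent_of_unique
    (h₁ : ∀ e f, e ≤ σ e → f ≤ σ f → σ.SameCycle e f → e = f) {e f : Fin (n + 1)}
    (he : e ≤ σ e) (hef : e ≤ f) (hf : f ≤ σ e) (hne : ¬ σ.SameCycle e f) :
    ∃ b, e ≤ σ b ∧ σ b < f ∧ f < b ∧ b ≤ σ e := by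
  -- `b` is the first element of the cycle at or above `f`. If `σ b` were not below `f`, minimality
  -- would make `b` a weak exceedance, forcing `b = e`.
  obtain ⟨b, hb, hmin⟩ := Finset.exists_min_image
    (Finset.univ.filter fun b => σ.SameCycle e b ∧ f ≤ b) id
    ⟨σ e, by simp [hf, Equiv.Perm.SameCycle.refl]⟩
  simp only [Finset.mem_filter, Finset.mem_univ, true_and, id] at hb hmin
  have hσb := Equiv.Perm.sameCycle_apply_right.2 hb.1
  have hfb : f < b := lt_of_le_of_ne hb.2 (by rintro rfl; exact hne hb.1)
  refine ⟨b, (sameCycle_bounds_of_unique h₁ he hσb).1, ?_, hfb,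
    (sameCycle_bounds_of_unique h₁ he hb.1).2⟩
  by_contra hcon
  have hbe := h₁ e b he (hmin _ ⟨hσb, not_lt.1 hcon⟩) hb.1
  exact absurd hef (not_le.2 (hbe ▸ hfb))

/-- The interval between `σ e` and `e` is cut by the face of `e`. -/
theorem exists_mem_exceedance_of_unique
    (h₂ : ∀ e f, (finRotate (n + 1) * σ) e ≤ e → (finRotate (n + 1) * σ) f ≤ f →
      (finRotate (n + 1) * σ).SameCycle e f → e = f) {e f : Fin (n + 1)}
    (he : σ e < e) (hf : σ e < f) (hfe : f < e) :
    ∃ g, σ e < g ∧ g ≤ f ∧ f ≤ σ g ∧ σ g < e := by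
  have hφe : (finRotate (n + 1) * σ) e ≤ e := (finRotate_mul_apply_le_iff σ e).2 (Or.inl he)
  have hv := coe_finRotate_of_ne_last (he.trans_le (Fin.le_last e)).ne
  -- `g` is the last element of the face at or below `f`; the image of `e`, namely `σ e + 1`, shows
  -- that one exists. As `e` is the only weak descent of this face, the face permutation moves `g`
  -- up, past `f` by maximality, but not past `e`.
  obtain ⟨g, hg, hmax⟩ := Finset.exists_max_image
    (Finset.univ.filter fun g => (finRotate (n + 1) * σ).SameCycle e g ∧ g ≤ f) id
    ⟨(finRotate (n + 1) * σ) e, by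
      simp only [Finset.mem_filter, Finset.mem_univ, true_and]
      refine ⟨Equiv.Perm.sameCycle_apply_right.2 (Equiv.Perm.SameCycle.refl _ _), ?_⟩
      rw [Equiv.Perm.mul_apply, Fin.le_def, hv]
      exact hf⟩
  simp only [Finset.mem_filter, Finset.mem_univ, true_and, id] at hg hmax
  have h1 : σ e < g := by
    have := hmax ((finRotate (n + 1) * σ) e)
      ⟨Equiv.Perm.sameCycle_apply_right.2 (Equiv.Perm.SameCycle.refl _ _), by
        rw [Equiv.Perm.mul_apply, Fin.le_def, hv]
        exact hf⟩
    rw [Equiv.Perm.mul_apply, Fin.le_def, hv] at this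
    exact this
  have h2 : ¬ (finRotate (n + 1) * σ) g ≤ g := fun hcon =>
    absurd (h₂ e g hφe hcon hg.1) (hg.2.trans_lt hfe).ne'
  have hcyc := Equiv.Perm.sameCycle_apply_right.2 hg.1
  have h3 : f < (finRotate (n + 1) * σ) g := by
    by_contra hcon
    exact h2 (hmax _ ⟨hcyc, not_lt.1 hcon⟩)
  have h4 := le_of_sameCycle_of_unique h₂ hφe hcyc
  rw [finRotate_mul_apply_le_iff, not_or] at h2
  have hv' := coe_finRotate_of_ne_last h2.2
  rw [Equiv.Perm.mul_apply, Fin.lt_def, hv'] at h3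
  rw [Equiv.Perm.mul_apply, Fin.le_def, hv'] at h4
  exact ⟨g, h1, hg.2, Nat.lt_succ_iff.1 h3, h4⟩

theorem noncrossing_of_unique
    (h₁ : ∀ e f, e ≤ σ e → f ≤ σ f → σ.SameCycle e f → e = f)
    (h₂ : ∀ e f, (finRotate (n + 1) * σ) e ≤ e → (finRotate (n + 1) * σ) f ≤ f →
      (finRotate (n + 1) * σ).SameCycle e f → e = f) : Noncrossing σ := by
  -- The two kinds of interval are handled by one induction on length: an exceedance interval is
  -- reduced to a descent interval no longer than itself, and a descent interval to an exceedance
  -- interval strictly inside it. The bounds, `< L` for exceedances and `≤ L` for descents, are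
  -- offset to make both reductions available.
  have key : ∀ L : ℕ,
      (∀ e, e ≤ σ e → (σ e : ℕ) < e + L → ∀ f, e ≤ f ∧ f ≤ σ e → e ≤ σ f ∧ σ f ≤ σ e) ∧
        ∀ e, σ e < e → (e : ℕ) ≤ σ e + L → ∀ f, σ e < f ∧ f < e → σ e < σ f ∧ σ f < e := by
    intro L
    induction L with
    | zero =>
      constructor <;> intro e he hL <;> simp only [Fin.le_def, Fin.lt_def] at he <;> omega
    | succ L ih =>
      constructor
      · intro e he hL f hf
        by_cases hef : σ.SameCycle e f
        · exact sameCycle_bounds_of_unique h₁ he (Equiv.Perm.sameCycle_apply_right.2 hef)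
        · obtain ⟨b, hb1, hb2, hb3, hb4⟩ := exists_mem_descent_of_unique h₁ he hf.1 hf.2 hef
          have := ih.2 b (hb2.trans hb3)
            (by simp only [Fin.le_def, Fin.lt_def] at *; omega) f ⟨hb2, hb3⟩
          exact ⟨hb1.trans this.1.le, this.2.le.trans hb4⟩
      · intro e he hL f hf
        obtain ⟨g, hg1, hg2, hg3, hg4⟩ := exists_mem_exceedance_of_unique h₂ he hf.1 hf.2
        have := ih.1 g (hg2.trans hg3)
          (by simp only [Fin.le_def, Fin.lt_def] at *; omega) f ⟨hg2, hg3⟩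
        exact ⟨hg1.trans_le this.1, this.2.trans_lt hg4⟩
  intro e f
  exact ⟨fun he => iff_apply_of_imp σ (p := fun f => σ e < f ∧ f < e)
      ((key e).2 e he (by omega)) f,
    fun he => iff_apply_of_imp σ (p := fun f => e ≤ f ∧ f ≤ σ e)
      ((key (n + 1)).1 e he (by omega)) f⟩

end Unique

theorem isPlanar_iff_noncrossing {n : ℕ} (hn : 0 < n) (M : TypedMap n) :
    M.IsPlanar ↔ Noncrossing M.white := by
  obtain ⟨n, rfl⟩ := Nat.exists_eq_succ_of_ne_zero hn.ne'
  rw [TypedMap.IsPlanar, numCycles_add_numCycles_eq_iff]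
  refine ⟨fun h => noncrossing_of_unique h.1 h.2, fun h => ⟨fun e f he hf hef =>
    h.eq_of_sameCycle he hf hef, fun e f he hf hef => le_antisymm ?_ ?_⟩⟩
  · exact h.le_of_sameCycle_face hf hef.symm
  · exact h.le_of_sameCycle_face he hef

/-! ### Direct sums of permutations -/

section DirectSum

variable {m k : ℕ}

/-- The permutation acting as `π` on the first `m` elements and as `τ` on the last `k` ones. -/
def directSum (π : Equiv.Perm (Fin m)) (τ : Equiv.Perm (Fin k)) : Equiv.Perm (Fin (m + k)) :=
  finSumFinEquiv.permCongr (Equiv.sumCongr π τ)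

variable (π : Equiv.Perm (Fin m)) (τ : Equiv.Perm (Fin k))

@[simp]
theorem directSum_castAdd (i : Fin m) :
    directSum π τ (Fin.castAdd k i) = Fin.castAdd k (π i) := by
  simp [directSum, Equiv.permCongr_apply]

@[simp]
theorem directSum_natAdd (i : Fin k) :
    directSum π τ (Fin.natAdd m i) = Fin.natAdd m (τ i) := by
  simp [directSum, Equiv.permCongr_apply]

theorem directSum_injective :
    Function.Injective fun p : Equiv.Perm (Fin m) × Equiv.Perm (Fin k) =>
      directSum p.1 p.2 := by
  rintro ⟨π, τ⟩ ⟨π', τ'⟩ h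
  have h' : ∀ x, directSum π τ x = directSum π' τ' x := fun x => congrArg (· x) h
  refine Prod.ext (Equiv.ext fun i => ?_) (Equiv.ext fun i => ?_)
  · simpa using h' (Fin.castAdd k i)
  · simpa using h' (Fin.natAdd m i)

theorem exists_eq_directSum {σ : Equiv.Perm (Fin (m + k))}
    (h : ∀ e : Fin (m + k), (e : ℕ) < m → (σ e : ℕ) < m) : ∃ π τ, σ = directSum π τ := by
  have hmem := Equiv.Perm.mem_sumCongrHom_range_of_perm_mapsTo_inl
    (σ := finSumFinEquiv.symm.permCongr σ) (by
      rintro _ ⟨i, rfl⟩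
      have hi := h (Fin.castAdd k i) i.2
      refine ⟨⟨_, hi⟩, ?_⟩
      rw [Equiv.permCongr_apply, Equiv.eq_symm_apply]
      simp)
  obtain ⟨⟨π, τ⟩, hp⟩ := hmem
  refine ⟨π, τ, ?_⟩
  have : directSum π τ = finSumFinEquiv.permCongr (finSumFinEquiv.symm.permCongr σ) :=
    congrArg _ hp
  rw [this]
  ext x
  simp [Equiv.permCongr_apply]

theorem noncrossing_directSum_iff :
    Noncrossing (directSum π τ) ↔ Noncrossing π ∧ Noncrossing τ := by
  constructor
  · intro h
    refine ⟨fun e f => ?_, fun e f => ?_⟩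
    · simpa only [directSum_castAdd, Fin.le_def, Fin.lt_def, Fin.val_castAdd] using
        h (Fin.castAdd k e) (Fin.castAdd k f)
    · simpa only [directSum_natAdd, Fin.le_def, Fin.lt_def, Fin.val_natAdd, Nat.add_lt_add_iff_left,
        Nat.add_le_add_iff_left] using
        h (Fin.natAdd m e) (Fin.natAdd m f)
  · rintro ⟨hπ, hτ⟩ e f
    induction e using Fin.addCases with
    | left e =>
      induction f using Fin.addCases with
      | left f =>
        simpa only [directSum_castAdd, Fin.le_def, Fin.lt_def, Fin.val_castAdd] using hπ e f
      | right f =>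
        simp only [directSum_castAdd, directSum_natAdd, Fin.le_def, Fin.lt_def, Fin.val_castAdd,
          Fin.val_natAdd]
        omega
    | right e =>
      induction f using Fin.addCases with
      | left f =>
        simp only [directSum_castAdd, directSum_natAdd, Fin.le_def, Fin.lt_def, Fin.val_castAdd,
          Fin.val_natAdd]
        omega
      | right f =>
        simpa only [directSum_natAdd, Fin.le_def, Fin.lt_def, Fin.val_natAdd, Nat.add_lt_add_iff_left,
          Nat.add_le_add_iff_left] using hτ e f

end DirectSum

instance {n : ℕ} : DecidablePred (Noncrossing (n := n)) := fun σ => by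
  unfold Noncrossing
  infer_instance

/-! ### Edgewise weights and splitting off the first petal -/

section Weight

variable {R : Type*} [CommRing R] (y c : R)

/-- The contribution of an edge `i` followed by the edge `j` around its white vertex. -/
def edgeWeight (i j : ℕ) : R :=
  (if i ≤ j then c else 1) * (if Odd (i + j) then y else 1)

/-- The weight of a noncrossing permutation, as a product over edges. -/
def permWeight {n : ℕ} (σ : Equiv.Perm (Fin n)) : R :=
  ∏ e : Fin n, edgeWeight y c e (σ e)

theorem permWeight_directSum {m k : ℕ} (π : Equiv.Perm (Fin m)) (τ : Equiv.Perm (Fin k)) :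
    permWeight y c (directSum π τ) = permWeight y c π * permWeight y c τ := by
  simp only [permWeight, Fin.prod_univ_add, directSum_castAdd, directSum_natAdd, Fin.val_castAdd,
    Fin.val_natAdd]
  congr 1
  refine Finset.prod_congr rfl fun i _ => ?_
  -- Shifting both labels by `m` preserves the parity of their sum.
  have h : m + ↑i + (m + ↑(τ i)) = 2 * m + (↑i + ↑(τ i)) := by ring
  have h' : Odd (2 * m + ((i : ℕ) + τ i)) ↔ Odd ((i : ℕ) + τ i) := by
    simp [Nat.odd_add (m := 2 * m), ← Nat.not_even_iff_odd]
  simp only [edgeWeight, h, h', Nat.add_le_add_iff_left]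

theorem TypedMap.type_eq {n : ℕ} (hn : 0 < n) (M : TypedMap n) (e : Fin n) :
    M.type e = xor (M.type ⟨0, hn⟩) (decide (Odd (e : ℕ))) := by
  obtain ⟨e, he⟩ := e
  induction e with
  | zero => simp
  | succ e ih =>
    rw [M.alternating ⟨e, by omega⟩ ⟨e + 1, he⟩ rfl, ih (by omega)]
    by_cases h : Odd e <;> simp [h, Nat.odd_add_one]

theorem TypedMap.type_ne_iff {n : ℕ} (M : TypedMap n) (e f : Fin n) :
    M.type f ≠ M.type e ↔ Odd ((e : ℕ) + f) := by
  have hn : 0 < n := e.pos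
  rw [M.type_eq hn e, M.type_eq hn f, Nat.odd_add]
  by_cases h : Odd (e : ℕ) <;> by_cases h' : Odd (f : ℕ) <;>
    simp [h, h', ← Nat.not_odd_iff_even]

/-- Each cycle has a unique weak exceedance, which carries its factor `c`; each factor `y` is
carried by an edge whose successor has the other type. -/
theorem TypedMap.weight_eq_permWeight {n : ℕ} (M : TypedMap n) (h : Noncrossing M.white) :
    M.weight y c = permWeight y c M.white := by
  have hcyc : Fintype.card M.WhiteVertex = Fintype.card {e : Fin n // e ≤ M.white e} := by
    refine (Fintype.card_of_bijective
      (f := fun e : {e : Fin n // e ≤ M.white e} => cycleOfEdge M.white e)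
      ⟨?_, surjective_cycleOfEdge_weakExceedance M.white⟩).symm
    rintro ⟨e, he⟩ ⟨f, hf⟩ hef
    exact Subtype.ext (h.eq_of_sameCycle he hf (cycleOfEdge_eq_iff.1 hef))
  have halt : ∑ v : M.WhiteVertex, M.alt v =
      (Finset.univ.filter fun e : Fin n => M.type (M.white e) ≠ M.type e).card := by
    rw [Finset.card_eq_sum_card_fiberwise (f := cycleOfEdge M.white) (t := Finset.univ)
      (fun _ _ => Finset.mem_coe.2 (Finset.mem_univ _))]
    refine Finset.sum_congr rfl fun v _ => ?_
    rw [TypedMap.alt, Finset.filter_filter]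
    congr 1
    ext e
    simp only [Finset.mem_filter, Finset.mem_univ, true_and]
    exact and_comm
  rw [TypedMap.weight, Finset.prod_mul_distrib, Finset.prod_const, Finset.prod_pow_eq_pow_sum,
    halt, Finset.card_univ, hcyc, Fintype.card_subtype]
  simp only [permWeight, edgeWeight, Finset.prod_mul_distrib, Finset.prod_ite, Finset.prod_const,
    one_pow, mul_one, M.type_ne_iff, Fin.le_def]

/-- The total weight of the noncrossing permutations of `n` edges. -/
def planarSum (n : ℕ) : R :=
  ∑ σ : Equiv.Perm (Fin n) with Noncrossing σ, permWeight y c σ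

/-- The noncrossing permutations that join the first element to the last one. -/
def IsPetalPerm {n : ℕ} (σ : Equiv.Perm (Fin n)) : Prop :=
  Noncrossing σ ∧ ∃ h : 0 < n, (σ ⟨0, h⟩ : ℕ) + 1 = n

instance {n : ℕ} : DecidablePred (IsPetalPerm (n := n)) := fun σ => by
  unfold IsPetalPerm
  infer_instance

/-- The total weight of the petal permutations of `n` edges. -/
def petalSum (n : ℕ) : R :=
  ∑ σ : Equiv.Perm (Fin n) with IsPetalPerm σ, permWeight y c σ

theorem petalSum_zero : petalSum y c 0 = 0 := by
  simp [petalSum, IsPetalPerm]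

theorem planarSum_zero : planarSum y c 0 = 1 := by
  rw [planarSum, Finset.filter_true_of_mem]
  · simp [permWeight]
  · exact fun σ _ e => e.elim0

theorem petalSum_one : petalSum y c 1 = c := by
  rw [petalSum, Finset.filter_true_of_mem]
  · simp [permWeight, edgeWeight]
  · intro σ _
    refine ⟨fun e f => ?_, one_pos, by simp⟩
    simp [Subsingleton.elim (σ e) e, Subsingleton.elim f e]

/-- The first edge is always a weak exceedance, so the initial segment up to its image is invariant
and the permutation is a direct sum along it. -/
theorem sum_noncrossing_apply_zero {m k : ℕ} (hm : 0 < m) :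
    ∑ σ : Equiv.Perm (Fin (m + k)) with
      Noncrossing σ ∧ (σ ⟨0, Nat.add_pos_left hm k⟩ : ℕ) + 1 = m, permWeight y c σ =
      petalSum y c m * planarSum y c k := by
  rw [petalSum, planarSum, Finset.sum_mul_sum, ← Finset.sum_product']
  symm
  refine Finset.sum_bij (fun p _ => directSum p.1 p.2) ?_ ?_ ?_ ?_
  · rintro ⟨π, τ⟩ hp
    simp only [Finset.mem_product, Finset.mem_filter, Finset.mem_univ, true_and] at hp ⊢
    refine ⟨(noncrossing_directSum_iff π τ).2 ⟨hp.1.1, hp.2⟩, ?_⟩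
    obtain ⟨h, h'⟩ := hp.1.2
    have := directSum_castAdd π τ ⟨0, hm⟩
    exact (congrArg (fun x : Fin (m + k) => (x : ℕ) + 1) this).trans h'
  · intro p _ q _ h
    exact directSum_injective h
  · intro σ hσ
    simp only [Finset.mem_filter, Finset.mem_univ, true_and] at hσ
    obtain ⟨hσ, h0⟩ := hσ
    obtain ⟨π, τ, rfl⟩ : ∃ π τ, σ = directSum π τ := by
      refine exists_eq_directSum fun e he => ?_
      have := ((hσ ⟨0, Nat.add_pos_left hm k⟩ e).2 (Nat.zero_le _)).1
      simp only [Fin.le_def] at this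
      omega
    have hnc := (noncrossing_directSum_iff π τ).1 hσ
    refine ⟨(π, τ), ?_, rfl⟩
    simp only [Finset.mem_product, Finset.mem_filter, Finset.mem_univ, true_and]
    refine ⟨⟨hnc.1, hm, ?_⟩, hnc.2⟩
    have := directSum_castAdd π τ ⟨0, hm⟩
    exact (congrArg (fun x : Fin (m + k) => (x : ℕ) + 1) this).symm.trans h0
  · rintro ⟨π, τ⟩ _
    exact (permWeight_directSum y c π τ).symm

/-- Decomposition of a noncrossing permutation into a first petal and the rest. -/
theorem sum_noncrossing_mul_eq_antidiagonal {n : ℕ} (hn : 0 < n) (g : ℕ → R) :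
    ∑ σ : Equiv.Perm (Fin n) with Noncrossing σ, g ((σ ⟨0, hn⟩ : ℕ) + 1) * permWeight y c σ =
      ∑ p ∈ Finset.HasAntidiagonal.antidiagonal n, g p.1 * (petalSum y c p.1 * planarSum y c p.2) := by
  rw [← Finset.sum_fiberwise_of_maps_to (t := Finset.HasAntidiagonal.antidiagonal n)
    (g := fun σ : Equiv.Perm (Fin n) => ((σ ⟨0, hn⟩ : ℕ) + 1, n - ((σ ⟨0, hn⟩ : ℕ) + 1)))
    (fun σ _ => by rw [Finset.HasAntidiagonal.mem_antidiagonal]; have := (σ ⟨0, hn⟩).2; omega)]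
  refine Finset.sum_congr rfl fun p hp => ?_
  obtain ⟨m, k⟩ := p
  rw [Finset.HasAntidiagonal.mem_antidiagonal] at hp
  simp only at hp
  subst hp
  rcases Nat.eq_zero_or_pos m with rfl | hm
  -- The first petal has at least one edge, so this fibre is empty, in agreement with `petalSum`
  -- being zero at `0`.
  · rw [petalSum_zero, zero_mul, mul_zero]
    refine Finset.sum_eq_zero fun σ hσ => ?_
    simp at hσ
  · rw [← sum_noncrossing_apply_zero y c hm, Finset.mul_sum, Finset.filter_filter]
    refine Finset.sum_congr (Finset.filter_congr fun σ _ => and_congr_right fun _ => ?_)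
      fun σ hσ => ?_
    · rw [Prod.ext_iff]
      simp only
      omega
    · simp only [Finset.mem_filter, Finset.mem_univ, true_and] at hσ
      simp only [hσ.2]

theorem planarSum_eq_antidiagonal {n : ℕ} (hn : 0 < n) :
    planarSum y c n =
      ∑ p ∈ Finset.HasAntidiagonal.antidiagonal n, petalSum y c p.1 * planarSum y c p.2 := by
  simpa [planarSum] using sum_noncrossing_mul_eq_antidiagonal y c hn fun _ => 1

end Weight

/-! ### Adding and removing the last edge of a petal -/

section LastEdge

variable {n : ℕ}

theorem directSum_one_last (π : Equiv.Perm (Fin n)) :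
    directSum π (1 : Equiv.Perm (Fin 1)) (Fin.last n) = Fin.last n :=
  directSum_natAdd π 1 0

theorem directSum_one_castSucc (π : Equiv.Perm (Fin n)) (i : Fin n) :
    directSum π (1 : Equiv.Perm (Fin 1)) i.castSucc = (π i).castSucc :=
  directSum_castAdd π 1 i

theorem noncrossing_one : Noncrossing (1 : Equiv.Perm (Fin 1)) := by
  decide

/-- Swapping two points outside a subset does not affect its invariance. -/
theorem forall_iff_mul_swap_iff {α : Type*} [DecidableEq α] (ρ : Equiv.Perm α) {a b : α}
    {p : α → Prop} (ha : ¬ p a) (hb : ¬ p b) :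
    (∀ f, p f ↔ p ((ρ * Equiv.swap a b) f)) ↔ ∀ f, p f ↔ p (ρ f) := by
  have hs : ∀ f, p (Equiv.swap a b f) ↔ p f := by
    intro f
    by_cases h : f = a
    · subst h; simp [ha, hb]
    · by_cases h' : f = b
      · subst h'; simp [ha, hb]
      · rw [Equiv.swap_apply_of_ne_of_ne h h']
  constructor
  · intro h f
    rw [← hs f, h (Equiv.swap a b f)]
    simp
  · intro h f
    rw [Equiv.Perm.mul_apply, ← h, hs]

theorem noncrossing_iff {σ : Equiv.Perm (Fin n)} :
    Noncrossing σ ↔ ∀ e,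
      (σ e < e → ∀ f, (σ e < f ∧ f < e) ↔ (σ e < σ f ∧ σ f < e)) ∧
        (e ≤ σ e → ∀ f, (e ≤ f ∧ f ≤ σ e) ↔ (e ≤ σ f ∧ σ f ≤ σ e)) := by
  refine forall_congr' fun e => ?_
  rw [forall_and, forall_comm, forall_comm (β := e ≤ σ e)]

/-- The swap inserts the last edge between `0` and `ρ 0` in their cycle. Intervals attached to any
other edge avoid both swapped points. At these two, the condition on `[0, ρ 0]` turns into the
condition on the open interval from `ρ 0` to the last edge, and the other condition is trivial. -/
theorem noncrossing_mul_swap_iff {ρ : Equiv.Perm (Fin (n + 1))} (hn : 0 < n)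
    (hρ : ρ (Fin.last n) = Fin.last n) :
    Noncrossing (ρ * Equiv.swap 0 (Fin.last n)) ↔ Noncrossing ρ := by
  have hz : (ρ * Equiv.swap 0 (Fin.last n)) 0 = Fin.last n := by simp [hρ]
  have hl : (ρ * Equiv.swap 0 (Fin.last n)) (Fin.last n) = ρ 0 := by simp
  have hs : ∀ e, e ≠ 0 → e ≠ Fin.last n → (ρ * Equiv.swap 0 (Fin.last n)) e = ρ e := by
    intro e h h'
    rw [Equiv.Perm.mul_apply, Equiv.swap_apply_of_ne_of_ne h h']
  have hlt : ∀ e, e ≠ Fin.last n → ρ e < Fin.last n := fun e he =>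
    Fin.lt_last_iff_ne_last.2 fun h => he (ρ.injective (h.trans hρ.symm))
  have h0 : (0 : Fin (n + 1)) ≠ Fin.last n := by
    rw [Ne, Fin.ext_iff]
    exact hn.ne
  -- Among the edges below the fixed last one, these two sets are complementary.
  have hroot : (∀ f, (ρ 0 < f ∧ f < Fin.last n) ↔ (ρ 0 < ρ f ∧ ρ f < Fin.last n)) ↔
      ∀ f, (0 ≤ f ∧ f ≤ ρ 0) ↔ (0 ≤ ρ f ∧ ρ f ≤ ρ 0) := by
    refine forall_congr' fun f => ?_
    by_cases hf : f = Fin.last n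
    · simp [hf, hρ]
    · simp only [hlt f hf, Fin.lt_last_iff_ne_last.2 hf, and_true, Fin.zero_le, true_and,
        ← not_le, not_iff_not]
  have hdesc : ∀ e, (∀ f, (ρ e < f ∧ f < e) ↔ (ρ e < (ρ * Equiv.swap 0 (Fin.last n)) f ∧
      (ρ * Equiv.swap 0 (Fin.last n)) f < e)) ↔
      ∀ f, (ρ e < f ∧ f < e) ↔ (ρ e < ρ f ∧ ρ f < e) := fun e =>
    forall_iff_mul_swap_iff ρ (p := fun f => ρ e < f ∧ f < e) (by simp)
      (fun h => absurd h.2 (not_lt.2 (Fin.le_last e)))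
  rw [noncrossing_iff, noncrossing_iff]
  constructor
  · intro h e
    by_cases he : e = Fin.last n
    · subst he
      simp only [hρ, lt_irrefl, false_imp_iff, true_and, Fin.le_last, and_true, le_refl,
        true_imp_iff, Fin.last_le_iff]
      exact fun f => ⟨fun hf => hf ▸ hρ, fun hf => ρ.injective (hf.trans hρ.symm)⟩
    · by_cases he0 : e = 0
      · subst he0
        refine ⟨fun h => absurd h (by simp), fun _ => hroot.1 ?_⟩
        have := (h (Fin.last n)).1
        rw [hl] at this
        exact forall_iff_mul_swap_iff ρ (p := fun f => ρ 0 < f ∧ f < Fin.last n) (by simp)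
          (by simp) |>.1 (this (hlt 0 h0))
      · have := h e
        rw [hs e he0 he, hdesc] at this
        exact ⟨this.1, fun hle => (forall_iff_mul_swap_iff ρ (p := fun f => e ≤ f ∧ f ≤ ρ e)
          (fun hp => he0 (Fin.le_zero_iff.1 hp.1)) (fun hp => absurd (hlt e he) (not_lt.2 hp.2))).1
          (this.2 hle)⟩
  · intro h e
    by_cases he : e = Fin.last n
    · subst he
      rw [hl]
      refine ⟨fun _ => ?_, fun hcon => absurd (hlt 0 h0) (not_lt.2 hcon)⟩
      exact forall_iff_mul_swap_iff ρ (p := fun f => ρ 0 < f ∧ f < Fin.last n) (by simp)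
        (by simp) |>.2 (hroot.2 ((h 0).2 (Fin.zero_le _)))
    · by_cases he0 : e = 0
      · subst he0
        rw [hz]
        exact ⟨fun h => absurd h (by simp), fun _ f => by simp [Fin.le_last]⟩
      · rw [hs e he0 he, hdesc]
        exact ⟨(h e).1, fun hle => (forall_iff_mul_swap_iff ρ (p := fun f => e ≤ f ∧ f ≤ ρ e)
          (fun hp => he0 (Fin.le_zero_iff.1 hp.1)) (fun hp => absurd (hlt e he) (not_lt.2 hp.2))).2
          ((h e).2 hle)⟩

/-- Inserting a last edge after the first one turns the noncrossing permutations of `n` edges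
into the petal permutations of `n + 1` edges. -/
def insertLast (π : Equiv.Perm (Fin n)) : Equiv.Perm (Fin (n + 1)) :=
  directSum π (1 : Equiv.Perm (Fin 1)) * Equiv.swap 0 (Fin.last n)

theorem insertLast_injective : Function.Injective (insertLast (n := n)) := by
  intro π π' h
  have := directSum_injective (a₁ := (π, 1)) (a₂ := (π', 1)) (mul_right_cancel h)
  exact congrArg Prod.fst this

theorem isPetalPerm_iff {σ : Equiv.Perm (Fin (n + 1))} :
    IsPetalPerm σ ↔ Noncrossing σ ∧ σ 0 = Fin.last n := by
  refine and_congr_right fun _ => ⟨?_, fun h => ⟨n.succ_pos, ?_⟩⟩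
  · rintro ⟨_, h⟩
    exact Fin.ext (Nat.succ.inj h)
  · exact congrArg (fun x : Fin (n + 1) => (x : ℕ) + 1) h

theorem isPetalPerm_insertLast (hn : 0 < n) {π : Equiv.Perm (Fin n)} (hπ : Noncrossing π) :
    IsPetalPerm (insertLast π) := by
  rw [isPetalPerm_iff, insertLast, noncrossing_mul_swap_iff hn (directSum_one_last π)]
  exact ⟨(noncrossing_directSum_iff π 1).2 ⟨hπ, noncrossing_one⟩, by
    rw [Equiv.Perm.mul_apply, Equiv.swap_apply_left, directSum_one_last]⟩

theorem exists_insertLast_eq (hn : 0 < n) {σ : Equiv.Perm (Fin (n + 1))} (hσ : IsPetalPerm σ) :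
    ∃ π, Noncrossing π ∧ insertLast π = σ := by
  rw [isPetalPerm_iff] at hσ
  have hρ : (σ * Equiv.swap 0 (Fin.last n)) (Fin.last n) = Fin.last n := by simp [hσ.2]
  obtain ⟨π, τ, h⟩ := exists_eq_directSum (m := n) (k := 1) (σ := σ * Equiv.swap 0 (Fin.last n))
    fun e he => by
      have hne : (σ * Equiv.swap 0 (Fin.last n)) e ≠ Fin.last n := fun hcon =>
        (Fin.ne_of_lt (b := Fin.last n) he)
          ((σ * Equiv.swap 0 (Fin.last n)).injective (hcon.trans hρ.symm))
      exact Fin.val_lt_last hne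
  obtain rfl : τ = 1 := Subsingleton.elim _ _
  have hσ' : σ = insertLast π := by
    rw [insertLast, ← h, mul_assoc, Equiv.swap_mul_self, mul_one]
  refine ⟨π, ?_, hσ'.symm⟩
  have hnc := hσ.1
  rw [hσ', insertLast, noncrossing_mul_swap_iff hn (directSum_one_last π),
    noncrossing_directSum_iff] at hnc
  exact hnc.1

variable {R : Type*} [CommRing R] (y c : R)

/-- The jump from `0` to `π 0` is replaced by `0` to `n` and `n` to `π 0`. The second is a descent,
so the power of `c` is unchanged; two new odd jumps replace an even one exactly when `n` is odd and
`π 0` even. -/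
theorem permWeight_insertLast (hn : 0 < n) (π : Equiv.Perm (Fin n)) :
    permWeight y c (insertLast π) =
      (if Odd n ∧ Odd ((π ⟨0, hn⟩ : ℕ) + 1) then y ^ 2 else 1) * permWeight y c π := by
  obtain ⟨n, rfl⟩ := Nat.exists_eq_succ_of_ne_zero hn.ne'
  have hz : insertLast π (Fin.castSucc 0) = Fin.last (n + 1) := by
    rw [insertLast, Equiv.Perm.mul_apply, Fin.castSucc_zero, Equiv.swap_apply_left,
      directSum_one_last]
  have hl : insertLast π (Fin.last (n + 1)) = (π 0).castSucc := by
    rw [insertLast, Equiv.Perm.mul_apply, Equiv.swap_apply_right, ← directSum_one_castSucc,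
      Fin.castSucc_zero]
  have hs : ∀ i : Fin n, insertLast π i.succ.castSucc = (π i.succ).castSucc := by
    intro i
    rw [insertLast, Equiv.Perm.mul_apply, Equiv.swap_apply_of_ne_of_ne, directSum_one_castSucc]
    · simp [Fin.ext_iff]
    · exact (Fin.castSucc_lt_last _).ne
  simp only [permWeight]
  rw [Fin.prod_univ_castSucc, Fin.prod_univ_succ, Fin.prod_univ_succ]
  simp only [hz, hl, hs, Fin.val_castSucc, Fin.val_last, Fin.val_zero]
  have h0 : (⟨0, hn⟩ : Fin (n + 1)) = 0 := rfl
  have hlt := (π 0).2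
  have hnot : ¬ n + 1 ≤ (π 0 : ℕ) := by omega
  simp only [edgeWeight, h0, hnot, Nat.zero_le, if_true, if_false, zero_add, one_mul,
    Nat.succ_eq_add_one]
  have h1 : Odd (n + 1 + (π 0 : ℕ)) ↔ (Odd (n + 1) ↔ ¬ Odd (π 0 : ℕ)) := by
    rw [Nat.odd_add, Nat.not_odd_iff_even]
  have h2 : Odd ((π 0 : ℕ) + 1) ↔ ¬ Odd (π 0 : ℕ) := Nat.odd_add_one
  by_cases h3 : Odd (n + 1) <;> by_cases h4 : Odd (π 0 : ℕ) <;>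
    simp only [h1, h2, h3, h4, not_true_eq_false, not_false_eq_true, if_true, if_false, and_true,
      and_false, and_self, iff_true, iff_false] <;> ring

/-- Decomposition of a petal into a petal ending at the preceding edge of the same vertex and a
noncrossing permutation. -/
theorem petalSum_succ_eq_antidiagonal (hn : 0 < n) :
    petalSum y c (n + 1) = ∑ p ∈ Finset.HasAntidiagonal.antidiagonal n,
      (if Odd n ∧ Odd p.1 then y ^ 2 else 1) * (petalSum y c p.1 * planarSum y c p.2) := by
  rw [← sum_noncrossing_mul_eq_antidiagonal y c hn fun m => if Odd n ∧ Odd m then y ^ 2 else 1,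
    petalSum]
  symm
  refine Finset.sum_bij (fun π _ => insertLast π) ?_ ?_ ?_ ?_
  · intro π hπ
    simp only [Finset.mem_filter, Finset.mem_univ, true_and] at hπ ⊢
    exact isPetalPerm_insertLast hn hπ
  · intro π _ π' _ h
    exact insertLast_injective h
  · intro σ hσ
    simp only [Finset.mem_filter, Finset.mem_univ, true_and] at hσ
    obtain ⟨π, hπ, h⟩ := exists_insertLast_eq hn hσ
    exact ⟨π, by simpa using hπ, h⟩
  · intro π _
    exact (permWeight_insertLast y c hn π).symm

end LastEdge

/-! ### Coefficients of the generating functions -/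

section GeneratingFunctions

variable {R : Type*} [CommRing R] (y c : R)

theorem TypedMap.ext_of_type_zero {n : ℕ} (hn : 0 < n) {M M' : TypedMap n}
    (hw : M.white = M'.white) (ht : M.type ⟨0, hn⟩ = M'.type ⟨0, hn⟩) : M = M' :=
  TypedMap.ext hw (funext fun e => by rw [M.type_eq hn, M'.type_eq hn, ht])

/-- The map with a given permutation and a given type of the first edge. -/
def TypedMap.ofPerm {n : ℕ} (σ : Equiv.Perm (Fin n)) (j : Bool) : TypedMap n where
  white := σ
  type e := xor j (decide (Odd (e : ℕ)))
  alternating e f h := by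
    rw [h]
    by_cases h' : Odd (e : ℕ) <;> simp [h', Nat.odd_add_one]

theorem Petal.val_secondEdge {n : ℕ} (P : Petal n) : (P.secondEdge : ℕ) + 1 = n := by
  obtain ⟨n, rfl⟩ := Nat.exists_eq_succ_of_ne_zero P.pos.ne'
  have h : P.secondEdge = Fin.last n := by
    rw [Petal.secondEdge, Petal.firstEdge, P.closed, Equiv.Perm.inv_eq_iff_eq, finRotate_last]
    rfl
  rw [h, Fin.val_last]

/-- The second external edge carries the last label `n - 1`, and types alternate from label `0`. -/
theorem Petal.secondType_eq_firstType_iff {n : ℕ} (P : Petal n) :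
    P.secondType = P.firstType ↔ Odd n := by
  have hn : Odd n ↔ ¬ Odd (P.secondEdge : ℕ) := by rw [← Nat.odd_add_one, P.val_secondEdge]
  rw [hn, Petal.secondType, P.type_eq P.pos, Petal.firstType, Petal.firstEdge]
  by_cases h : Odd (P.secondEdge : ℕ) <;> simp [h]

theorem Petal.isPetalPerm {n : ℕ} (P : Petal n) : IsPetalPerm P.white :=
  ⟨(isPlanar_iff_noncrossing P.pos _).1 P.planar, P.pos, P.val_secondEdge⟩

theorem Petal.exists_white_eq {n : ℕ} {σ : Equiv.Perm (Fin n)} (hσ : IsPetalPerm σ) (j : Bool) :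
    ∃ P : Petal n, P.firstType = j ∧ P.white = σ := by
  obtain ⟨h, hn, h0⟩ := hσ
  refine ⟨⟨TypedMap.ofPerm σ j, hn, (isPlanar_iff_noncrossing hn _).2 h, ?_⟩, ?_, rfl⟩
  · obtain ⟨n, rfl⟩ := Nat.exists_eq_succ_of_ne_zero hn.ne'
    rw [Equiv.Perm.eq_inv_iff_eq]
    have : σ ⟨0, hn⟩ = Fin.last n := Fin.ext (Nat.succ.inj h0)
    change finRotate (n + 1) (σ ⟨0, hn⟩) = _
    rw [this, finRotate_last]
    rfl
  · simp [Petal.firstType, Petal.firstEdge, TypedMap.ofPerm]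

/-- A petal is determined by its permutation and its first type; the second type is then forced by
the parity of `n`. -/
theorem coeff_B (i j : Bool) (n : ℕ) :
    PowerSeries.coeff n (B y c i j) = if (i = j ↔ Odd n) then petalSum y c n else 0 := by
  rw [B, PowerSeries.coeff_mk]
  split_ifs with h
  · rw [petalSum]
    refine Finset.sum_bij (fun P _ => P.white) ?_ ?_ ?_ ?_
    · intro P _
      simpa using P.isPetalPerm
    · intro P hP P' hP' hw
      simp only [Finset.mem_filter, Finset.mem_univ, true_and] at hP hP'
      refine Petal.ext hw ?_
      exact congrArg TypedMap.type
        (TypedMap.ext_of_type_zero P.pos hw (hP.2.trans hP'.2.symm))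
    · intro σ hσ
      simp only [Finset.mem_filter, Finset.mem_univ, true_and] at hσ
      obtain ⟨P, hP, hw⟩ := Petal.exists_white_eq hσ j
      refine ⟨P, ?_, hw⟩
      have hodd := P.secondType_eq_firstType_iff
      rw [← h, hP] at hodd
      simp only [Finset.mem_filter, Finset.mem_univ, true_and]
      refine ⟨?_, hP⟩
      revert hodd
      cases P.secondType <;> cases i <;> cases j <;> simp
    · intro P _
      exact P.weight_eq_permWeight y c P.isPetalPerm.1
  · refine Finset.sum_eq_zero fun P hP => absurd ?_ h
    simp only [Finset.mem_filter, Finset.mem_univ, true_and] at hP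
    rw [← P.secondType_eq_firstType_iff, hP.1, hP.2]

theorem coeff_S_zero (i j : Bool) :
    PowerSeries.coeff 0 (S y c i j) = if i = !j then 1 else 0 := by
  have h : ∀ l : List (Σ n, Petal n), numEdges l = 0 → l = [] := by
    rintro (_ | ⟨P, l⟩) hl
    · rfl
    · have := P.2.pos
      simp only [numEdges, List.map_cons, List.sum_cons] at hl
      omega
  rw [S, PowerSeries.coeff_mk]
  split_ifs with hij
  · rw [Finset.sum_eq_single []]
    · simp
    · intro l hl hne
      simp only [Set.Finite.mem_toFinset] at hl
      exact absurd (h l hl.2) hne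
    · intro hcon
      have hmem : [] ∈ petalSeqs i j 0 := ⟨hij, rfl⟩
      exact absurd ((Set.Finite.mem_toFinset _).2 hmem) hcon
  · refine Finset.sum_eq_zero fun l hl => ?_
    simp only [Set.Finite.mem_toFinset] at hl
    obtain ⟨h1, h2⟩ := hl
    rw [h l h2] at h1
    exact absurd h1 hij

/-- A nonempty sequence of petals consists of a first petal and a sequence of petals. -/
theorem coeff_S_of_pos (i j : Bool) {N : ℕ} (hN : 0 < N) :
    PowerSeries.coeff N (S y c i j) = ∑ p ∈ Finset.HasAntidiagonal.antidiagonal N,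
      ∑ k : Bool, PowerSeries.coeff p.1 (B y c k j) *
        PowerSeries.coeff p.2 (S y c i (!k)) := by
  have h1 : ∀ p : ℕ × ℕ, ∑ k : Bool, PowerSeries.coeff p.1 (B y c k j) *
      PowerSeries.coeff p.2 (S y c i (!k)) = ∑ P : Petal p.1 with P.firstType = j,
        ∑ l ∈ (finite_petalSeqs i (!P.secondType) p.2).toFinset,
          P.weight y c * (l.map fun P => P.2.weight y c).prod := by
    intro p
    rw [← Finset.sum_fiberwise (g := fun P : Petal p.1 => P.secondType)]
    refine Finset.sum_congr rfl fun k _ => ?_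
    rw [B, PowerSeries.coeff_mk, Finset.sum_mul, Finset.filter_filter]
    refine Finset.sum_congr (Finset.filter_congr fun P _ => and_comm) fun P hP => ?_
    simp only [Finset.mem_filter, Finset.mem_univ, true_and] at hP
    rw [S, PowerSeries.coeff_mk, Finset.mul_sum, hP.2]
  simp only [h1]
  rw [Finset.sum_sigma', Finset.sum_sigma', S, PowerSeries.coeff_mk]
  symm
  refine Finset.sum_bij (fun q _ => (⟨q.1.1.1, q.1.2⟩ : Σ n, Petal n) :: q.2) ?_ ?_ ?_ ?_
  · rintro ⟨⟨p, P⟩, l⟩ hq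
    simp only [Finset.mem_sigma, Finset.mem_filter, Finset.mem_univ, true_and,
      Finset.HasAntidiagonal.mem_antidiagonal, Set.Finite.mem_toFinset] at hq ⊢
    refine ⟨⟨hq.1.2, hq.2.1⟩, ?_⟩
    have := hq.2.2
    simp only [numEdges, List.map_cons, List.sum_cons] at this ⊢
    omega
  · rintro ⟨⟨⟨m, k⟩, P⟩, l⟩ hq ⟨⟨⟨m', k'⟩, P'⟩, l'⟩ hq' h
    simp only [Finset.mem_sigma, Finset.HasAntidiagonal.mem_antidiagonal] at hq hq'
    simp only [List.cons.injEq, Sigma.mk.injEq] at h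
    obtain ⟨⟨rfl, hP⟩, rfl⟩ := h
    obtain rfl := eq_of_heq hP
    obtain rfl : k = k' := by omega
    rfl
  · rintro (_ | ⟨⟨m, P⟩, l⟩) hl
    · simp only [Set.Finite.mem_toFinset] at hl
      exact absurd hl.2 hN.ne
    · simp only [Set.Finite.mem_toFinset] at hl
      have hsum : m + numEdges l = N := by simpa [numEdges] using hl.2
      refine ⟨⟨⟨(m, numEdges l), P⟩, l⟩, ?_, rfl⟩
      simp only [Finset.mem_sigma, Finset.mem_filter, Finset.mem_univ, true_and,
        Finset.HasAntidiagonal.mem_antidiagonal, Set.Finite.mem_toFinset]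
      exact ⟨⟨hsum, hl.1.1⟩, hl.1.2, rfl⟩
  · rintro ⟨⟨p, P⟩, l⟩ _
    simp

/-- Both sides satisfy the recursion that splits off a first petal. The induction leaves `j` free
because the remaining sequence starts with a type dictated by that petal. -/
theorem coeff_S (i j : Bool) (N : ℕ) :
    PowerSeries.coeff N (S y c i j) = if (i = j ↔ Odd N) then planarSum y c N else 0 := by
  induction N using Nat.strong_induction_on generalizing j with
  | _ N ih =>
    rcases Nat.eq_zero_or_pos N with rfl | hN
    · rw [coeff_S_zero, planarSum_zero]
      cases i <;> cases j <;> simp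
    · rw [coeff_S_of_pos y c i j hN, planarSum_eq_antidiagonal y c hN]
      have hrhs : ∀ s : R, (if (i = j ↔ Odd N) then s else 0) =
          (if (i = j ↔ Odd N) then 1 else 0) * s := fun s => by split_ifs <;> simp
      rw [hrhs, Finset.mul_sum]
      refine Finset.sum_congr rfl fun p hp => ?_
      rw [Finset.HasAntidiagonal.mem_antidiagonal] at hp
      rcases Nat.eq_zero_or_pos p.1 with h0 | h0
      · simp [coeff_B, h0, petalSum_zero]
      · rw [Fintype.sum_bool, ih p.2 (by omega), ih p.2 (by omega), coeff_B, coeff_B]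
        have hodd : Odd N ↔ (Odd p.1 ↔ ¬ Odd p.2) := by
          rw [← hp, Nat.odd_add, Nat.not_odd_iff_even]
        -- For each size of the first petal, only one second type `k` is compatible with its parity.
        by_cases h1 : Odd p.1 <;> by_cases h2 : Odd p.2 <;> cases i <;> cases j <;>
          simp [hodd, h1, h2]

theorem coeff_succ_X_mul_S_mul_B (i j k l : Bool) (n : ℕ) :
    PowerSeries.coeff (n + 1) (PowerSeries.X * S y c i j * B y c k l) =
      ∑ p ∈ Finset.HasAntidiagonal.antidiagonal n,
        (if (k = l ↔ Odd p.1) ∧ (i = j ↔ Odd p.2) then 1 else 0) *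
          (petalSum y c p.1 * planarSum y c p.2) := by
  rw [mul_assoc, PowerSeries.coeff_succ_X_mul, mul_comm, PowerSeries.coeff_mul]
  refine Finset.sum_congr rfl fun p _ => ?_
  rw [coeff_B, coeff_S]
  split_ifs <;> simp_all

end GeneratingFunctions

end PetalMaps

/-! ### The two functional equations -/

theorem proposition3p4 {R : Type*} [CommRing R] (y c : R) (a : Bool) :
    PetalMaps.B y c a a =
        PowerSeries.C c * PowerSeries.X
          + PowerSeries.X * PetalMaps.S y c (!a) (!a) * PetalMaps.B y c a a
          + PowerSeries.X * PetalMaps.S y c (!a) a * PetalMaps.B y c (!a) a ∧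
      PetalMaps.B y c a (!a) =
        PowerSeries.X * PetalMaps.S y c (!a) (!a) * PetalMaps.B y c a (!a)
          + PowerSeries.C (y ^ 2) * PowerSeries.X * PetalMaps.S y c (!a) a
              * PetalMaps.B y c (!a) (!a) := by
  constructor
  · refine PowerSeries.ext fun N => ?_
    rcases N with _ | n
    · simp [PetalMaps.coeff_B, mul_assoc]
    · rw [map_add, map_add, PetalMaps.coeff_succ_X_mul_S_mul_B,
        PetalMaps.coeff_succ_X_mul_S_mul_B, PetalMaps.coeff_B, PowerSeries.coeff_C_mul,
        PowerSeries.coeff_X]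
      rcases Nat.eq_zero_or_pos n with rfl | hn
      -- The one-edge petal accounts for the term `c x`.
      · simp [PetalMaps.petalSum_one, PetalMaps.petalSum_zero]
      · rw [PetalMaps.petalSum_succ_eq_antidiagonal y c hn, add_assoc, ← Finset.sum_add_distrib,
          if_neg (show ¬ n + 1 = 1 by omega), mul_zero, zero_add, ← mul_boole, mul_comm, Finset.mul_sum]
        refine Finset.sum_congr rfl fun p hp => ?_
        rw [Finset.HasAntidiagonal.mem_antidiagonal] at hp
        have h1 : Odd n ↔ (Odd p.1 ↔ ¬ Odd p.2) := by
          rw [← hp, Nat.odd_add, Nat.not_odd_iff_even]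
        have h2 : Odd (n + 1) ↔ ¬ Odd n := Nat.odd_add_one
        -- Only even `n` contributes, so no factor `y ^ 2` appears: both parts odd gives the first
        -- product, both even the second.
        by_cases h3 : Odd p.1 <;> by_cases h4 : Odd p.2 <;> simp [h1, h2, h3, h4]
  · refine PowerSeries.ext fun N => ?_
    rcases N with _ | n
    · simp [PetalMaps.coeff_B, PetalMaps.petalSum_zero, mul_assoc]
    · rw [map_add, mul_assoc (PowerSeries.C _), mul_assoc (PowerSeries.C _),
        PowerSeries.coeff_C_mul, PetalMaps.coeff_succ_X_mul_S_mul_B,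
        PetalMaps.coeff_succ_X_mul_S_mul_B, PetalMaps.coeff_B]
      rcases Nat.eq_zero_or_pos n with rfl | hn
      · simp
      · rw [PetalMaps.petalSum_succ_eq_antidiagonal y c hn, Finset.mul_sum,
          ← Finset.sum_add_distrib, ← mul_boole, mul_comm, Finset.mul_sum]
        refine Finset.sum_congr rfl fun p hp => ?_
        rw [Finset.HasAntidiagonal.mem_antidiagonal] at hp
        have h1 : Odd n ↔ (Odd p.1 ↔ ¬ Odd p.2) := by
          rw [← hp, Nat.odd_add, Nat.not_odd_iff_even]
        have h2 : Odd (n + 1) ↔ ¬ Odd n := Nat.odd_add_one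
        -- Only odd `n` contributes: an even petal part gives the first product with factor one, an
        -- odd petal part the second with factor `y ^ 2`.
        by_cases h3 : Odd p.1 <;> by_cases h4 : Odd p.2 <;> simp [h1, h2, h3, h4]
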